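/- Let $\Gamma$ be a torsionless grading monoid, that is, a commutative cancellative monoid (written additively) whose quotient group is torsion-free, and let $R=\bigoplus_{\alpha\in\Gamma}R_\alpha$ be a (commutative) integral domain graded by $\Gamma$. For $a\in R$ let $C(a)$ be the ideal of $R$ generated by the homogeneous components of $a$, and for $f=f_0+f_1X+\cdots+f_nX^n\in R[X]$ let $\mathcal{A}_f:=\sum_{i=0}^n C(f_i)$ be the homogeneous content ideal of $f$. Call $R$ a graded-Prüfer domain if every nonzero finitely generated homogeneous ideal $I$ of $R$ is invertible, i.e. $II^{-1}=R$, where $I^{-1}=\{x\in K : xI\subseteq R\}$ and $K$ is the quotient field of $R$. Then $R$ is a graded-Prüfer domain if and only if $\mathcal{A}_f\mathcal{A}_g=\mathcal{A}_{fg}$ for all $f,g\in R[X]$. -/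

import Mathlib

open scoped Polynomial nonZeroDivisors

namespace GradedDomain

/-- The homogeneous ideal `C(a)` generated by the homogeneous components of `a`. -/
noncomputable def compIdeal {Γ R : Type*} [AddCancelCommMonoid Γ] [DecidableEq Γ] [CommRing R]
    (𝒜 : Γ → AddSubgroup R) [GradedRing 𝒜] (a : R) : Ideal R :=
  Ideal.span (Set.range fun γ : Γ => (DirectSum.decompose 𝒜 a γ : R))

/-- The homogeneous content ideal `C(f₀) + ⋯ + C(fₙ)` of `f = f₀ + f₁ X + ⋯ + fₙ Xⁿ`. -/
noncomputable def homContent {Γ R : Type*} [AddCancelCommMonoid Γ] [DecidableEq Γ] [CommRing R]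
    (𝒜 : Γ → AddSubgroup R) [GradedRing 𝒜] (f : R[X]) : Ideal R :=
  ∑ i ∈ Finset.range (f.natDegree + 1), compIdeal 𝒜 (f.coeff i)

/-- A graded domain is graded-Prüfer if every nonzero finitely generated homogeneous ideal `I`
is invertible: `I I⁻¹ = R`, where `I⁻¹ = (R : I)` is taken in the quotient field of `R`. -/
def IsGradedPrufer {Γ R : Type*} [AddCancelCommMonoid Γ] [DecidableEq Γ] [CommRing R] [IsDomain R]
    (𝒜 : Γ → AddSubgroup R) [GradedRing 𝒜] : Prop :=
  ∀ I : Ideal R, I ≠ ⊥ → I.FG → I.IsHomogeneous 𝒜 →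
    (I : FractionalIdeal R⁰ (FractionRing R)) * (I : FractionalIdeal R⁰ (FractionRing R))⁻¹ = 1

end GradedDomain

/-! Forward: under `a ↦ ∑ a_γ t^γ`, `𝒜_f` becomes the coefficient ideal of a polynomial over `R[Γ]`.
As `Γ` has unique sums, `(R/M)[Γ][X]` is a domain for every prime `M`, so coefficient ideals not
inside `M` multiply to one not inside `M`. Invertibility replaces localization at `M`: it allows
rescaling into that situation (`exists_rescaling`, `coeffIdeal_mul_of_hasCofactor`). Backward: two
well-chosen products of linear polynomials make `(a, b)` invertible for nonzero homogeneous `a`, `b`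
(`hasCofactor_homogeneous_pair`). The identity `sup_mul_eq_prod_sup` passes from pairs to any finite
set of generators. -/

namespace GradedDomain

/-! ### Invertibility inside `R`, and reduction to two generators -/

section Cofactor

variable {R : Type*} [CommRing R]

/-- Some multiple of `I` is principal with a nonzero generator; over a domain this is
invertibility. -/
def HasCofactor (I : Ideal R) : Prop :=
  ∃ (J : Ideal R) (q : R), q ≠ 0 ∧ I * J = Ideal.span {q}

theorem HasCofactor.of_mul {I J : Ideal R} (h : HasCofactor (I * J)) : HasCofactor I := by
  obtain ⟨K, q, hq, h⟩ := h
  exact ⟨J * K, q, hq, by rw [← mul_assoc, h]⟩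

/-- The identity behind the reduction of invertibility to ideals with fewer generators. -/
theorem sup_mul_eq_prod_sup (I J K : Ideal R) :
    (I ⊔ (J ⊔ K)) * (I * J ⊔ J * K ⊔ K * I) = (I ⊔ J) * (J ⊔ K) * (I ⊔ K) := by
  have h : I * J * K + I * J * K = I * J * K := sup_idem _
  simp only [← Submodule.add_eq_sup]
  calc (I + (J + K)) * (I * J + J * K + K * I)
      = I ^ 2 * J + I ^ 2 * K + J ^ 2 * I + J ^ 2 * K + K ^ 2 * I + K ^ 2 * J
        + ((I * J * K + I * J * K) + I * J * K) := by ring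
    _ = I ^ 2 * J + I ^ 2 * K + J ^ 2 * I + J ^ 2 * K + K ^ 2 * I + K ^ 2 * J
        + (I * J * K + I * J * K) := by rw [h, h]
    _ = (I + J) * (J + K) * (I + K) := by ring

variable [IsDomain R]

/-- A fractional inverse is `q⁻¹K` with `K` integral, so clearing denominators passes between the
two sides. -/
theorem hasCofactor_iff_mul_inv_eq_one (I : Ideal R) :
    HasCofactor I ↔
      (I : FractionalIdeal R⁰ (FractionRing R)) * (I : FractionalIdeal R⁰ (FractionRing R))⁻¹ = 1 := by
  rw [FractionalIdeal.mul_inv_cancel_iff]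
  constructor
  · rintro ⟨J, q, hq, h⟩
    have hq' : algebraMap R (FractionRing R) q ≠ 0 := by
      simpa using hq
    refine ⟨J * FractionalIdeal.spanSingleton R⁰ (algebraMap R (FractionRing R) q)⁻¹, ?_⟩
    rw [← mul_assoc, ← FractionalIdeal.coeIdeal_mul, h, FractionalIdeal.coeIdeal_span_singleton,
      FractionalIdeal.spanSingleton_mul_spanSingleton, mul_inv_cancel₀ hq',
      FractionalIdeal.spanSingleton_one]
  · rintro ⟨J, hJ⟩
    obtain ⟨q, K, hq, rfl⟩ := FractionalIdeal.exists_eq_spanSingleton_mul J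
    have hq' : algebraMap R (FractionRing R) q ≠ 0 := by
      simpa using hq
    refine ⟨K, q, hq, ?_⟩
    rw [← FractionalIdeal.coeIdeal_inj (K := FractionRing R), FractionalIdeal.coeIdeal_mul,
      FractionalIdeal.coeIdeal_span_singleton]
    have h := congrArg
      (FractionalIdeal.spanSingleton R⁰ (algebraMap R (FractionRing R) q) * ·) hJ
    simp only [mul_one] at h
    rw [← h, mul_left_comm, ← mul_assoc (FractionalIdeal.spanSingleton R⁰ _),
      FractionalIdeal.spanSingleton_mul_spanSingleton, mul_inv_cancel₀ hq',
      FractionalIdeal.spanSingleton_one, one_mul]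

theorem HasCofactor.mul {I J : Ideal R} (hI : HasCofactor I) (hJ : HasCofactor J) :
    HasCofactor (I * J) := by
  obtain ⟨I', q, hq, h⟩ := hI
  obtain ⟨J', r, hr, h'⟩ := hJ
  exact ⟨I' * J', q * r, mul_ne_zero hq hr, by
    rw [mul_mul_mul_comm, h, h', Ideal.span_singleton_mul_span_singleton]⟩

/-- With `s = {a, b} ∪ t`, `sup_mul_eq_prod_sup` makes `(s)` a factor of `(a, b)(b, t)(a, t)`, whose
factors are covered by hypothesis and induction. -/
theorem hasCofactor_span_of_pairs (s : Finset R) (hs : s.Nonempty)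
    (h : ∀ a ∈ s, ∀ b ∈ s, HasCofactor (Ideal.span {a, b})) :
    HasCofactor (Ideal.span (s : Set R)) := by
  classical
  induction s using Finset.strongInduction with
  | H s ih =>
    obtain ⟨a, ha⟩ := hs
    obtain ⟨u, hau, rfl⟩ : ∃ u, a ∉ u ∧ insert a u = s :=
      ⟨s.erase a, Finset.notMem_erase _ _, Finset.insert_erase ha⟩
    rcases u.eq_empty_or_nonempty with rfl | ⟨b, hb⟩
    · simpa using h a (by simp) a (by simp)
    obtain ⟨t, hbt, rfl⟩ : ∃ t, b ∉ t ∧ insert b t = u :=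
      ⟨u.erase b, Finset.notMem_erase _ _, Finset.insert_erase hb⟩
    rcases t.eq_empty_or_nonempty with rfl | ht
    · simpa using h a (by simp) b (by simp)
    have hab : a ≠ b := by rintro rfl; simp at hau
    have hat : a ∉ t := fun h' => hau (Finset.mem_insert_of_mem h')
    have h₁ := h a (by simp) b (by simp)
    have h₂ := ih (insert b t) (Finset.ssubset_insert hau) (by simp)
      fun x hx y hy => h x (Finset.mem_insert_of_mem hx) y (Finset.mem_insert_of_mem hy)
    have hsub : insert a t ⊆ insert a (insert b t) :=
      Finset.insert_subset_insert _ (Finset.subset_insert _ _)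
    have h₃ := ih (insert a t)
      (Finset.ssubset_iff_subset_ne.2 ⟨hsub, fun he => by
        have : b ∈ insert a t := he ▸ (by simp)
        rcases Finset.mem_insert.1 this with h' | h'
        · exact hab h'.symm
        · exact hbt h'⟩) (by simp)
      fun x hx y hy => h x (hsub hx) y (hsub hy)
    rw [Finset.coe_insert, Ideal.span_insert] at h₂ h₃
    rw [Ideal.span_insert] at h₁
    rw [Finset.coe_insert, Finset.coe_insert, Ideal.span_insert, Ideal.span_insert]
    refine HasCofactor.of_mul (J := Ideal.span {a} * Ideal.span {b} ⊔
      Ideal.span {b} * Ideal.span (t : Set R) ⊔ Ideal.span (t : Set R) * Ideal.span {a}) ?_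
    rw [sup_mul_eq_prod_sup]
    exact (h₁.mul h₂).mul h₃

theorem hasCofactor_pair {a b x y w : R} (ha : a ≠ 0) (hb : b ≠ 0)
    (h : a * b = x * a ^ 2 + y * b ^ 2) (hw : x * a = b * w) :
    HasCofactor (Ideal.span {a, b}) := by
  refine ⟨Ideal.span {x * a, y * b}, a * b, mul_ne_zero ha hb, ?_⟩
  rw [Ideal.span_pair_mul_span_pair]
  apply le_antisymm
  · rw [Ideal.span_le]
    rintro z (rfl | rfl | rfl | rfl) <;> rw [SetLike.mem_coe, Ideal.mem_span_singleton]
    · exact ⟨w, by rw [hw]; ring⟩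
    · exact ⟨y, by ring⟩
    · exact ⟨x, by ring⟩
    -- `y * b ^ 2 = a * b - x * a ^ 2 = a * b * (1 - w)`.
    · exact ⟨1 - w, by linear_combination -h - a * hw⟩
  · rw [Ideal.span_singleton_le_iff_mem]
    have h' : a * b = a * (x * a) + b * (y * b) := by rw [h]; ring
    rw [h']
    exact Ideal.add_mem _ (Ideal.subset_span (by simp)) (Ideal.subset_span (by simp))

end Cofactor

/-! ### Gauss's lemma for coefficient ideals over `R[Γ]` -/

section CoeffIdeal

variable {Γ R : Type*} [AddCancelCommMonoid Γ] [CommRing R]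

/-- The ideal generated by all coefficients in `R` of a polynomial over the monoid algebra. -/
def coeffIdeal (P : (AddMonoidAlgebra R Γ)[X]) : Ideal R :=
  Ideal.span (Set.range fun p : ℕ × Γ => (P.coeff p.1).coeff p.2)

theorem coeff_mem_coeffIdeal (P : (AddMonoidAlgebra R Γ)[X]) (i : ℕ) (γ : Γ) :
    (P.coeff i).coeff γ ∈ coeffIdeal P :=
  Ideal.subset_span ⟨(i, γ), rfl⟩

theorem coeffIdeal_le_iff {P : (AddMonoidAlgebra R Γ)[X]} {I : Ideal R} :
    coeffIdeal P ≤ I ↔ ∀ i γ, (P.coeff i).coeff γ ∈ I := by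
  rw [coeffIdeal, Ideal.span_le]
  exact ⟨fun h i γ => h ⟨(i, γ), rfl⟩, by rintro h _ ⟨p, rfl⟩; exact h _ _⟩

theorem coeffIdeal_fg (P : (AddMonoidAlgebra R Γ)[X]) : (coeffIdeal P).FG := by
  classical
  refine Submodule.fg_span (Set.Finite.subset
    (((P.support.biUnion fun i => (P.coeff i).coeff.support.image (P.coeff i).coeff)
      ∪ {0}).finite_toSet) ?_)
  rintro _ ⟨⟨i, γ⟩, rfl⟩
  by_cases h : (P.coeff i).coeff γ = 0
  · simp [h]
  · simp only [Finset.coe_union, Set.mem_union, Finset.mem_coe, Finset.mem_biUnion,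
      Finset.mem_image, Finsupp.mem_support_iff, Polynomial.mem_support_iff]
    refine Or.inl ⟨i, fun h' => h (by simp [h']), γ, h, rfl⟩

theorem coeffIdeal_mul_le (P Q : (AddMonoidAlgebra R Γ)[X]) :
    coeffIdeal (P * Q) ≤ coeffIdeal P * coeffIdeal Q := by
  classical
  rw [coeffIdeal_le_iff]
  intro i γ
  rw [Polynomial.coeff_mul, AddMonoidAlgebra.coeff_sum, Finsupp.finsetSum_apply]
  refine Ideal.sum_mem _ fun p _ => ?_
  rw [AddMonoidAlgebra.coeff_mul, Finsupp.sum]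
  refine Ideal.sum_mem _ fun α _ => ?_
  rw [Finsupp.sum]
  refine Ideal.sum_mem _ fun β _ => ?_
  split_ifs
  · exact Ideal.mul_mem_mul (coeff_mem_coeffIdeal _ _ _) (coeff_mem_coeffIdeal _ _ _)
  · exact zero_mem _

/-- Division of all coefficients by a common divisor. -/
theorem exists_smul_eq_of_dvd_coeff {q : R} {P : (AddMonoidAlgebra R Γ)[X]}
    (h : ∀ i γ, q ∣ (P.coeff i).coeff γ) : ∃ Q : (AddMonoidAlgebra R Γ)[X], q • Q = P := by
  have key : ∀ x : AddMonoidAlgebra R Γ, (∀ γ, q ∣ x.coeff γ) →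
      ∃ y : AddMonoidAlgebra R Γ, q • y = x := by
    intro x hx
    choose d hd using hx
    refine ⟨∑ γ ∈ x.coeff.support, AddMonoidAlgebra.single γ (d γ), ?_⟩
    rw [Finset.smul_sum]
    conv_rhs => rw [← AddMonoidAlgebra.sum_coeff_single x]
    refine Finset.sum_congr rfl fun γ _ => ?_
    rw [AddMonoidAlgebra.smul_single, smul_eq_mul, ← hd]
  choose d hd using fun i => key (P.coeff i) (h i)
  refine ⟨∑ i ∈ P.support, Polynomial.monomial i (d i), ?_⟩
  rw [Finset.smul_sum]
  conv_rhs => rw [P.as_sum_support]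
  refine Finset.sum_congr rfl fun i _ => ?_
  rw [Polynomial.smul_monomial, hd]

/-- Unique sums are a local property, so finitely generated submonoids suffice. -/
theorem uniqueSums_of_isAddTorsionFree (Γ : Type*) [AddCancelCommMonoid Γ] [IsAddTorsionFree Γ] :
    UniqueSums Γ where
  uniqueAdd_of_nonempty {A B} hA hB := by
    classical
    let N := AddSubmonoid.closure ((A ∪ B : Finset Γ) : Set Γ)
    let _ : AddCancelCommMonoid N := Subtype.val_injective.addCancelCommMonoid _ rfl
      (fun _ _ => rfl) fun _ _ => rfl
    have : IsAddTorsionFree N := Subtype.val_injective.isAddTorsionFree N.subtype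
    have hfg : AddMonoid.FG N := AddMonoid.closure_finset_fg _
    have hmem : ∀ S : Finset Γ, S ⊆ A ∪ B → S = (S.subtype (· ∈ N)).image N.subtype := by
      intro S hS
      ext a
      simp only [Finset.mem_image, Finset.mem_subtype, AddSubmonoid.subtype_apply]
      exact ⟨fun ha => ⟨⟨a, AddSubmonoid.subset_closure (hS ha)⟩, ha, rfl⟩,
        by rintro ⟨x, hx, rfl⟩; exact hx⟩
    have hA' := hmem A Finset.subset_union_left
    have hB' := hmem B Finset.subset_union_right
    obtain ⟨a, ha, b, hb, h⟩ := UniqueSums.uniqueAdd_of_nonempty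
      (Finset.image_nonempty.1 (hA' ▸ hA)) (Finset.image_nonempty.1 (hB' ▸ hB))
    refine ⟨a, Finset.mem_subtype.1 ha, b, Finset.mem_subtype.1 hb, ?_⟩
    rw [hA', hB']
    exact (UniqueAdd.addHom_image_iff N.subtype.toAddHom Subtype.val_injective).2 h

theorem coeffIdeal_mul_not_le_of_isPrime [IsAddTorsionFree Γ] {P Q : (AddMonoidAlgebra R Γ)[X]} {M : Ideal R}
    [M.IsPrime] (hP : ¬ coeffIdeal P ≤ M) (hQ : ¬ coeffIdeal Q ≤ M) :
    ¬ coeffIdeal (P * Q) ≤ M := by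
  have := uniqueSums_of_isAddTorsionFree Γ
  let π := Polynomial.mapRingHom (AddMonoidAlgebra.mapRingHom Γ (Ideal.Quotient.mk M))
  have hπ : ∀ T : (AddMonoidAlgebra R Γ)[X], coeffIdeal T ≤ M ↔ π T = 0 := by
    intro T
    simp only [coeffIdeal_le_iff, Polynomial.ext_iff, AddMonoidAlgebra.ext_iff, Finsupp.ext_iff]
    simp [π, Ideal.Quotient.eq_zero_iff_mem]
  rw [hπ] at hP hQ ⊢
  rw [map_mul]
  exact mul_ne_zero hP hQ

variable [IsDomain R]

/-- An invertible coefficient ideal lets `P` be rescaled to be nonzero modulo a proper ideal. -/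
theorem exists_rescaling {P : (AddMonoidAlgebra R Γ)[X]} {J M : Ideal R} {q : R} (hq : q ≠ 0)
    (h : coeffIdeal P * J = Ideal.span {q}) (hM : M ≠ ⊤) :
    ∃ p ∈ J, ∃ P' : (AddMonoidAlgebra R Γ)[X], q • P' = p • P ∧ ¬ coeffIdeal P' ≤ M := by
  -- If every rescaling fell into `M`, then `(q) = coeffIdeal P * J ≤ q M`, forcing `1 ∈ M`.
  by_contra! hcon
  have hle : coeffIdeal P * J ≤ Ideal.span {q} * M := by
    rw [Ideal.mul_le]
    intro r hr p hp
    have hdvd : ∀ s ∈ coeffIdeal P, q ∣ p * s := fun s hs => by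
      rw [← Ideal.mem_span_singleton, ← h, mul_comm p]
      exact Ideal.mul_mem_mul hs hp
    obtain ⟨P', hP'⟩ := exists_smul_eq_of_dvd_coeff (q := q) (P := p • P) fun i γ => by
      simpa using hdvd _ (coeff_mem_coeffIdeal P i γ)
    have hP'M := coeffIdeal_le_iff.1 (hcon p hp P' hP')
    have hr' : coeffIdeal P ≤ Submodule.comap (LinearMap.mulRight R p) (Ideal.span {q} * M) := by
      rw [coeffIdeal_le_iff]
      intro i γ
      have hc : q * (P'.coeff i).coeff γ = p * (P.coeff i).coeff γ := by
        simpa using congrArg (fun T : (AddMonoidAlgebra R Γ)[X] => (T.coeff i).coeff γ) hP'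
      rw [Submodule.mem_comap, LinearMap.mulRight_apply, mul_comm _ p, ← hc]
      exact Ideal.mul_mem_mul (Ideal.mem_span_singleton_self q) (hP'M i γ)
    exact hr' hr
  rw [h, Ideal.span_singleton_le_iff_mem, Ideal.mem_span_singleton_mul] at hle
  obtain ⟨m, hm, hqm⟩ := hle
  have : m = 1 := mul_left_cancel₀ hq (by rw [hqm, mul_one])
  exact hM ((Ideal.eq_top_iff_one M).2 (this ▸ hm))

/-- It suffices that `q q' ∈ coeffIdeal (P * Q) * J * J'`: multiply by both coefficient ideals and
cancel `q q'`. -/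
theorem coeffIdeal_mul_of_hasCofactor [IsAddTorsionFree Γ] {P Q : (AddMonoidAlgebra R Γ)[X]}
    (hP : HasCofactor (coeffIdeal P)) (hQ : HasCofactor (coeffIdeal Q)) :
    coeffIdeal P * coeffIdeal Q = coeffIdeal (P * Q) := by
  refine le_antisymm ?_ (coeffIdeal_mul_le P Q)
  obtain ⟨J, q, hq, hJ⟩ := hP
  obtain ⟨J', q', hq', hJ'⟩ := hQ
  have hqq : q * q' ≠ 0 := mul_ne_zero hq hq'
  set K := coeffIdeal (P * Q) * (J * J') with hK
  have hmem : q * q' ∈ K := by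
    by_contra hcon
    -- This comap is the colon ideal `(K : q q')`. A maximal `M` above it would contain all
    -- coefficients of the rescaled product `P' * Q'`, against Gauss's lemma modulo `M`.
    have hI : Submodule.comap (LinearMap.mulLeft R (q * q')) K ≠ ⊤ := fun ht => hcon (by
      have : (1 : R) ∈ Submodule.comap (LinearMap.mulLeft R (q * q')) K := ht ▸ Submodule.mem_top
      simpa using this)
    obtain ⟨M, hM, hIM⟩ := Ideal.exists_le_maximal _ hI
    obtain ⟨p, hp, P', hP', hPM⟩ := exists_rescaling hq hJ hM.ne_top
    obtain ⟨p', hp', Q', hQ', hQM⟩ := exists_rescaling hq' hJ' hM.ne_top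
    have := hM.isPrime
    refine coeffIdeal_mul_not_le_of_isPrime hPM hQM (le_trans ?_ hIM)
    rw [coeffIdeal_le_iff]
    intro i γ
    have hprod : (q * q') • (P' * Q') = (p * p') • (P * Q) := by
      rw [← smul_mul_smul_comm, hP', hQ', smul_mul_smul_comm]
    have hc : q * q' * ((P' * Q').coeff i).coeff γ = p * p' * ((P * Q).coeff i).coeff γ := by
      have := congrArg (fun T : (AddMonoidAlgebra R Γ)[X] => (T.coeff i).coeff γ) hprod
      simpa only [Polynomial.coeff_smul, AddMonoidAlgebra.coeff_smul, Finsupp.smul_apply,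
        smul_eq_mul] using this
    rw [Submodule.mem_comap, LinearMap.mulLeft_apply, hc, mul_comm]
    exact Ideal.mul_mem_mul (coeff_mem_coeffIdeal _ _ _) (Ideal.mul_mem_mul hp hp')
  have hprod : coeffIdeal P * coeffIdeal Q * (J * J') = Ideal.span {q * q'} := by
    rw [mul_mul_mul_comm, hJ, hJ', Ideal.span_singleton_mul_span_singleton]
  rw [← Ideal.span_singleton_mul_right_mono hqq]
  calc Ideal.span {q * q'} * (coeffIdeal P * coeffIdeal Q)
      ≤ K * (coeffIdeal P * coeffIdeal Q) :=
        Ideal.mul_mono_left ((Ideal.span_singleton_le_iff_mem _).2 hmem)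
    _ = Ideal.span {q * q'} * coeffIdeal (P * Q) := by rw [hK, ← hprod]; ring

end CoeffIdeal

/-! ### Homogeneous content as a coefficient ideal, and homogeneous pairs -/

section Graded

variable {Γ R : Type*} [AddCancelCommMonoid Γ] [DecidableEq Γ] [CommRing R]
  (𝒜 : Γ → AddSubgroup R) [GradedRing 𝒜]

/-- The embedding of a graded ring into its monoid algebra, `a ↦ ∑ a_γ t^γ`. -/
noncomputable def toMonoidAlgebra : R →+* AddMonoidAlgebra R Γ :=
  (DirectSum.toSemiring (fun γ => (AddMonoidAlgebra.singleAddHom γ).comp (𝒜 γ).subtype)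
    (by simp [AddMonoidAlgebra.one_def]) (by simp [AddMonoidAlgebra.single_mul_single])).comp
    (DirectSum.decomposeRingEquiv 𝒜 : R →+* _)

theorem coeff_toMonoidAlgebra (a : R) (γ : Γ) :
    (toMonoidAlgebra 𝒜 a).coeff γ = DirectSum.decompose 𝒜 a γ := by
  have h : toMonoidAlgebra 𝒜 a = DirectSum.toSemiring
      (fun γ => (AddMonoidAlgebra.singleAddHom γ).comp (𝒜 γ).subtype)
      (by simp [AddMonoidAlgebra.one_def]) (by simp [AddMonoidAlgebra.single_mul_single])
      (DirectSum.decompose 𝒜 a) := rfl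
  rw [h]
  induction DirectSum.decompose 𝒜 a using DirectSum.induction_on with
  | zero => simp
  | of i x =>
    rw [DirectSum.toSemiring_of, DirectSum.coe_of_apply]
    simp only [AddMonoidHom.comp_apply, AddSubgroup.coe_subtype,
      AddMonoidAlgebra.singleAddHom_apply, AddMonoidAlgebra.coeff_single, Finsupp.single_apply]
    split_ifs <;> rfl
  | add x y hx hy => rw [map_add, AddMonoidAlgebra.coeff_add, Finsupp.add_apply, hx, hy]; rfl

theorem homContent_eq_coeffIdeal (f : R[X]) :
    homContent 𝒜 f = coeffIdeal (f.map (toMonoidAlgebra 𝒜)) := by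
  rw [homContent, Ideal.sum_eq_sup]
  apply le_antisymm
  · refine Finset.sup_le fun i _ => ?_
    rw [compIdeal, Ideal.span_le]
    rintro _ ⟨γ, rfl⟩
    have := coeff_mem_coeffIdeal (f.map (toMonoidAlgebra 𝒜)) i γ
    rwa [Polynomial.coeff_map, coeff_toMonoidAlgebra] at this
  · rw [coeffIdeal_le_iff]
    intro i γ
    rw [Polynomial.coeff_map, coeff_toMonoidAlgebra]
    rcases le_or_gt i f.natDegree with hi | hi
    · exact Finset.le_sup (f := fun i => compIdeal 𝒜 (f.coeff i)) (Finset.mem_range_succ_iff.2 hi)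
        (Ideal.subset_span ⟨γ, rfl⟩)
    · simp [Polynomial.coeff_eq_zero_of_natDegree_lt hi]

theorem decompose_coeff_mem_homContent (f : R[X]) (i : ℕ) (γ : Γ) :
    (DirectSum.decompose 𝒜 (f.coeff i) γ : R) ∈ homContent 𝒜 f := by
  rw [homContent_eq_coeffIdeal, ← coeff_toMonoidAlgebra, ← Polynomial.coeff_map]
  exact coeff_mem_coeffIdeal _ _ _

theorem coeff_mem_homContent (f : R[X]) (i : ℕ) : f.coeff i ∈ homContent 𝒜 f := by
  classical
  rw [← DirectSum.sum_support_decompose 𝒜 (f.coeff i)]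
  exact Ideal.sum_mem _ fun γ _ => decompose_coeff_mem_homContent 𝒜 f i γ

theorem homContent_le {f : R[X]} {I : Ideal R} (hI : I.IsHomogeneous 𝒜)
    (h : ∀ i, f.coeff i ∈ I) : homContent 𝒜 f ≤ I := by
  rw [homContent_eq_coeffIdeal, coeffIdeal_le_iff]
  intro i γ
  rw [Polynomial.coeff_map, coeff_toMonoidAlgebra]
  exact hI γ (h i)

theorem homContent_isHomogeneous (f : R[X]) : (homContent 𝒜 f).IsHomogeneous 𝒜 := by
  rw [homContent_eq_coeffIdeal]
  refine Ideal.homogeneous_span 𝒜 _ ?_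
  rintro _ ⟨p, rfl⟩
  simp only [Polynomial.coeff_map, coeff_toMonoidAlgebra]
  exact SetLike.isHomogeneousElem_coe _

theorem homContent_fg (f : R[X]) : (homContent 𝒜 f).FG := by
  rw [homContent_eq_coeffIdeal]
  exact coeffIdeal_fg _

theorem homContent_zero : homContent 𝒜 (0 : R[X]) = ⊥ := by
  rw [eq_bot_iff]
  exact homContent_le 𝒜 (Ideal.IsHomogeneous.bot 𝒜) (by simp)

theorem homContent_ne_bot {f : R[X]} (hf : f ≠ 0) : homContent 𝒜 f ≠ ⊥ := by
  intro h
  refine hf (Polynomial.ext fun i => ?_)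
  have := coeff_mem_homContent 𝒜 f i
  rwa [h, Ideal.mem_bot] at this

theorem exists_finset_homogeneous_span {I : Ideal R} (hI : I.IsHomogeneous 𝒜) (hfg : I.FG) :
    ∃ s : Finset R, (∀ a ∈ s, a ≠ 0 ∧ SetLike.IsHomogeneousElem 𝒜 a) ∧
      Ideal.span (s : Set R) = I := by
  classical
  obtain ⟨t, rfl⟩ := hfg
  let s : Finset R := (t.biUnion fun a => (DirectSum.decompose 𝒜 a).support.image
    fun γ => (DirectSum.decompose 𝒜 a γ : R)).filter (· ≠ 0)
  refine ⟨s, fun a ha => ?_, le_antisymm ?_ ?_⟩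
  · obtain ⟨ha, h0⟩ := Finset.mem_filter.1 ha
    simp only [Finset.mem_biUnion, Finset.mem_image] at ha
    obtain ⟨b, _, γ, _, rfl⟩ := ha
    exact ⟨h0, SetLike.isHomogeneousElem_coe _⟩
  · rw [Ideal.span_le]
    intro a ha
    obtain ⟨ha, -⟩ := Finset.mem_filter.1 (Finset.mem_coe.1 ha)
    simp only [Finset.mem_biUnion, Finset.mem_image] at ha
    obtain ⟨b, hb, γ, _, rfl⟩ := ha
    exact hI γ (Ideal.subset_span hb)
  · change Submodule.span R (t : Set R) ≤ _
    rw [Submodule.span_le]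
    intro a ha
    rw [SetLike.mem_coe, ← DirectSum.sum_support_decompose 𝒜 a]
    refine Ideal.sum_mem _ fun γ hγ => ?_
    by_cases h0 : (DirectSum.decompose 𝒜 a γ : R) = 0
    · rw [h0]; exact zero_mem _
    · refine Ideal.subset_span (Finset.mem_coe.2 (Finset.mem_filter.2 ⟨?_, h0⟩))
      exact Finset.mem_biUnion.2 ⟨a, ha, Finset.mem_image.2 ⟨γ, hγ, rfl⟩⟩

variable [IsDomain R]

theorem hasCofactor_homogeneous_pair
    (h : ∀ f g : R[X], homContent 𝒜 f * homContent 𝒜 g = homContent 𝒜 (f * g)) {a b : R}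
    (ha : a ≠ 0) (hb : b ≠ 0) (hah : SetLike.IsHomogeneousElem 𝒜 a)
    (hbh : SetLike.IsHomogeneousElem 𝒜 b) : HasCofactor (Ideal.span {a, b}) := by
  open Polynomial in
  have hsq : ∀ {c : R}, SetLike.IsHomogeneousElem 𝒜 c → SetLike.IsHomogeneousElem 𝒜 (c ^ 2) := by
    rintro c ⟨i, hi⟩
    exact ⟨_, SetLike.pow_mem_graded 2 hi⟩
  have hab : a * b ∈ Ideal.span {a ^ 2, b ^ 2} := by
    -- The cross terms of `(a + bX)(a - bX)` cancel, leaving only `a²` and `-b²`.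
    let f : R[X] := C b * X + C a
    let g : R[X] := C (-b) * X + C a
    have hf : a ∈ homContent 𝒜 f := by simpa [f] using coeff_mem_homContent 𝒜 f 0
    have hg : b ∈ homContent 𝒜 g := by simpa [g] using coeff_mem_homContent 𝒜 g 1
    have hle : homContent 𝒜 (f * g) ≤ Ideal.span {a ^ 2, b ^ 2} := by
      refine homContent_le 𝒜 (Ideal.homogeneous_span 𝒜 _ ?_) fun i => ?_
      · rintro _ (rfl | rfl)
        exacts [hsq hah, hsq hbh]
      · have : f * g = C (a ^ 2) - C (b ^ 2) * X ^ 2 := by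
          simp only [f, g, C_neg, C_pow]; ring
        rw [this, coeff_sub, coeff_C, coeff_C_mul]
        refine sub_mem ?_ (Ideal.mul_mem_right _ _ (Ideal.subset_span (by simp)))
        split_ifs
        exacts [Ideal.subset_span (by simp), zero_mem _]
    exact hle (h f g ▸ Ideal.mul_mem_mul hf hg)
  obtain ⟨x, y, hxy⟩ := Ideal.mem_span_pair.1 hab
  have hxb : x * a * b ∈ Ideal.span {b ^ 2} := by
    -- Since `ab = xa² + yb²`, the fraction `xa/b` is a root of the monic `X² - X + xy`, the other
    -- root being `1 - xa/b`. Clearing denominators factors `b²(X² - X + xy)` over `R`, and the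
    -- content formula forces `xa/b` into `R`. Here `x` need not be homogeneous; only `(b²)` must
    -- be.
    let f : R[X] := C b * X - C (x * a)
    let g : R[X] := C b * X - C (b - x * a)
    have hf : x * a ∈ homContent 𝒜 f := by
      have := neg_mem (coeff_mem_homContent 𝒜 f 0)
      simpa [f] using this
    have hg : b ∈ homContent 𝒜 g := by
      have := coeff_mem_homContent 𝒜 g 1
      simpa [g, coeff_C] using this
    have hle : homContent 𝒜 (f * g) ≤ Ideal.span {b ^ 2} := by
      refine homContent_le 𝒜 (Ideal.homogeneous_span 𝒜 _ ?_) fun i => ?_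
      · rintro _ rfl
        exact hsq hbh
      · have : f * g = C (b ^ 2) * (X ^ 2 - X + C (x * y)) := by
          have h' : x * a * (b - x * a) = b ^ 2 * (x * y) := by linear_combination -x * hxy
          have h'' : C (x * a) * C (b - x * a) = C (b ^ 2) * C (x * y) := by
            rw [← C_mul, h', C_mul]
          simp only [f, g]
          rw [mul_add, ← h'']
          simp only [C_sub, C_pow]; ring
        rw [this, coeff_C_mul]
        exact Ideal.mul_mem_right _ _ (Ideal.mem_span_singleton_self _)
    exact hle (h f g ▸ Ideal.mul_mem_mul hf hg)
  obtain ⟨w, hw⟩ := Ideal.mem_span_singleton.1 hxb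
  exact hasCofactor_pair (w := w) ha hb hxy.symm
    (mul_right_cancel₀ hb (by rw [hw]; ring))

end Graded

end GradedDomain

open GradedDomain in
theorem mainTheorem5 {Γ R : Type*} [AddCancelCommMonoid Γ] [IsAddTorsionFree Γ] [DecidableEq Γ]
    [CommRing R] [IsDomain R] (𝒜 : Γ → AddSubgroup R) [GradedRing 𝒜] :
    GradedDomain.IsGradedPrufer 𝒜 ↔
      ∀ f g : R[X],
        GradedDomain.homContent 𝒜 f * GradedDomain.homContent 𝒜 g =
          GradedDomain.homContent 𝒜 (f * g) := by
  constructor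
  · intro h f g
    -- The Prüfer condition covers nonzero ideals only, so zero polynomials are treated apart.
    rcases eq_or_ne f 0 with rfl | hf
    · rw [zero_mul, homContent_zero, Ideal.bot_mul]
    rcases eq_or_ne g 0 with rfl | hg
    · rw [mul_zero, homContent_zero, Ideal.mul_bot]
    have key : ∀ f : R[X], f ≠ 0 → HasCofactor (coeffIdeal (f.map (toMonoidAlgebra 𝒜))) := by
      intro f hf
      rw [← homContent_eq_coeffIdeal, hasCofactor_iff_mul_inv_eq_one]
      exact h _ (homContent_ne_bot 𝒜 hf) (homContent_fg 𝒜 f) (homContent_isHomogeneous 𝒜 f)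
    simp only [homContent_eq_coeffIdeal, Polynomial.map_mul]
    exact coeffIdeal_mul_of_hasCofactor (key f hf) (key g hg)
  · intro h I hI hfg hhom
    rw [← hasCofactor_iff_mul_inv_eq_one]
    obtain ⟨s, hs, rfl⟩ := exists_finset_homogeneous_span 𝒜 hhom hfg
    refine hasCofactor_span_of_pairs s ?_ fun a ha b hb =>
      hasCofactor_homogeneous_pair 𝒜 h (hs a ha).1 (hs b hb).1 (hs a ha).2 (hs b hb).2
    rw [Finset.nonempty_iff_ne_empty]
    rintro rfl
    exact hI (by simp)
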